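/- For a scheme $X$ of finite type over $\mathbb{Z}$ let $[X]$ denote the function $q\mapsto \#X(\mathbb{F}_q)$ from the set $\mathcal{Q}$ of prime powers to $\mathbb{Z}\subset\mathbb{Q}$. Let $\mathcal{S}\subset\mathbb{Z}[q]$ be the saturated multiplicative system generated by the polynomials $q^n-q$, $n>1$, and let $\mathsf{R}=\mathcal{S}^{-1}\mathbb{Z}[q]$. Since the elements of $\mathcal{S}$ do not vanish on $\mathcal{Q}$, $\mathsf{R}$ acts by pointwise multiplication on functions $\mathcal{Q}\to\mathbb{Q}$. For a finite simple graph $G$ with vertices $v_1,\dots,v_n$ let $Z_G$ be the scheme over $\mathbb{Z}$ of all nondegenerate symmetric $n\times n$ matrices $M$ with $M_{ij}=0$ whenever there is an edge from $v_i$ to $v_j$; that is, $Z_G=\operatorname{Spec}\,(\mathbb{Z}[y_{ij}]/J)_{\det(y_{ij})}$, where $J$ is generated by all $y_{ij}-y_{ji}$ and by the $y_{ij}$ for which $v_iv_j$ is an edge. Let $\mathbf{Graphs}_*$ be the $\mathsf{R}$-module of functions $\mathcal{Q}\to\mathbb{Q}$ generated by all $[Z_G]$, for $G$ a finite simple graph.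 For a matroid $M$ on a finite set $E$, with rank function $\rho$ and rank $r=\rho(E)$, let $X(M)$ be the scheme over $\mathbb{Z}$ of representations of $M$ in $r$-space: the locally closed subscheme of the affine space of $E\times r$ matrices (regarded as functions $f$ from $E$ to $r$-space) on which, for every $A\subseteq E$, all $(\rho(A)+1)\times(\rho(A)+1)$ minors with rows in $A$ vanish and at least one $\rho(A)\times\rho(A)$ minor with rows in $A$ is invertible. Thus, for a field $K$, $X(M)(K)$ is the set of all maps $f:E\to K^r$ with $\dim\operatorname{span} f(A)=\rho(A)$ for all $A\subseteq E$. Let $\mathbf{Matroids}$ be the $\mathsf{R}$-module of functions $\mathcal{Q}\to\mathbb{Q}$ generated by all $[X(M)]$, for $M$ a finite matroid. Theorem. $\mathbf{Matroids}\subset\mathbf{Graphs}_*$. -/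

import Mathlib

noncomputable section

open Polynomial AlgebraicGeometry

namespace GraphMatroid

/-! ### The ring `R = S⁻¹ ℤ[q]` and its action on functions of a prime power -/

/-- The set of prime powers `q = p ^ k`, `k ≥ 1`. -/
abbrev PrimePower : Type := {q : ℕ // IsPrimePow q}

/-- The saturated multiplicative system in `ℤ[q]` generated by the `q ^ n - q` for `n > 1`. -/
def denominators : Submonoid ℤ[X] :=
  (Submonoid.closure {f : ℤ[X] | ∃ n : ℕ, 1 < n ∧ f = X ^ n - X}).saturation.toSubmonoid

/-- The ring `S⁻¹ ℤ[q]`. -/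
abbrev R : Type := Localization denominators

/-- A polynomial in `ℤ[q]` as a function on prime powers. -/
def evalPoly : ℤ[X] →+* (PrimePower → ℚ) :=
  RingHom.pi fun q => Polynomial.eval₂RingHom (Int.castRingHom ℚ) (q.1 : ℚ)

theorem evalPoly_apply (f : ℤ[X]) (q : PrimePower) :
    evalPoly f q = f.eval₂ (Int.castRingHom ℚ) (q.1 : ℚ) := rfl

theorem isUnit_evalPoly (s : denominators) : IsUnit (evalPoly s) := by
  obtain ⟨s, hs⟩ := s
  change IsUnit (evalPoly s)
  have hs' : s ∈ (Submonoid.closure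
    {f : ℤ[X] | ∃ n : ℕ, 1 < n ∧ f = X ^ n - X}).saturation := hs
  rw [Submonoid.mem_saturation_iff_exists_dvd] at hs'
  obtain ⟨t, ht, hst⟩ := hs'
  refine isUnit_of_dvd_unit (map_dvd evalPoly hst) ?_
  suffices h : Submonoid.closure {f : ℤ[X] | ∃ n : ℕ, 1 < n ∧ f = X ^ n - X} ≤
      (IsUnit.submonoid (PrimePower → ℚ)).comap evalPoly from h ht
  rw [Submonoid.closure_le]
  rintro _ ⟨n, hn, rfl⟩
  change IsUnit (evalPoly _)
  rw [Pi.isUnit_iff]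
  intro q
  rw [isUnit_iff_ne_zero, evalPoly_apply]
  have hq : (1 : ℚ) < (q.1 : ℚ) := by exact_mod_cast q.2.one_lt
  have h := pow_lt_pow_right₀ hq hn
  rw [pow_one] at h
  simpa [sub_eq_zero] using h.ne'

/-- An element of `R` as an (everywhere defined) function from prime powers to `ℚ`. -/
def evalR : R →+* (PrimePower → ℚ) :=
  IsLocalization.lift (M := denominators) isUnit_evalPoly

/-- The `R`-module structure on functions from prime powers to `ℚ`: an element of `R` acts by
pointwise multiplication with its values. -/
instance : Module R (PrimePower → ℚ) := Module.compHom _ evalR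

/-! ### Counting points of schemes -/

instance (q : PrimePower) : Fact (Nat.minFac q.1).Prime :=
  ⟨Nat.minFac_prime q.2.ne_one⟩

/-- The field with `q` elements: `q = p ^ k` with `p` the smallest prime factor of `q` and `k` the
multiplicity of `p` in `q`. -/
abbrev Fq (q : PrimePower) : Type :=
  GaloisField q.1.minFac (q.1.factorization q.1.minFac)

/-- The function `[X] : q ↦ # X(𝔽_q)`. -/
def pointCount (Y : Scheme.{0}) : PrimePower → ℚ :=
  fun q => (Nat.card (Spec (CommRingCat.of (Fq q)) ⟶ Y) : ℚ)

/-! ### The schemes `Z_G` -/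

/-- The ideal of `ℤ[y_{vw}]` generated by `y_{vw} - y_{wv}` for all `v, w`, and by `y_{vw}` for all
edges `vw` of `G`. -/
def symIdeal {V : Type} (G : SimpleGraph V) : Ideal (MvPolynomial (V × V) ℤ) :=
  Ideal.span ({f | ∃ v w, f = MvPolynomial.X (v, w) - MvPolynomial.X (w, v)} ∪
    {f | ∃ v w, G.Adj v w ∧ f = MvPolynomial.X (v, w)})

open Classical in
/-- The determinant of the generic matrix `(y_{vw})`, in the quotient by `symIdeal G`. -/
def symDet {V : Type} [Fintype V] (G : SimpleGraph V) :
    MvPolynomial (V × V) ℤ ⧸ symIdeal G :=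
  Ideal.Quotient.mk (symIdeal G)
    (Matrix.det (Matrix.of fun v w : V => (MvPolynomial.X (v, w) : MvPolynomial (V × V) ℤ)))

/-- `Z_G`: the scheme of nondegenerate symmetric matrices, with rows and columns indexed by the
vertices of `G`, whose `(v, w)` entry vanishes whenever `vw` is an edge of `G`. -/
def ZScheme {V : Type} [Fintype V] (G : SimpleGraph V) : Scheme.{0} :=
  Spec (CommRingCat.of (Localization.Away (symDet G)))

/-! ### The representation schemes of matroids -/

/-- The `k × k` minors of the generic `E × s` matrix `(y_{ej})` whose rows lie in `A ⊆ E`. -/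
def minors {E : Type} (s : ℕ) (A : Set E) (k : ℕ) : Set (MvPolynomial (E × Fin s) ℤ) :=
  {f | ∃ (a : Fin k ↪ E) (b : Fin k ↪ Fin s), (∀ i, a i ∈ A) ∧
    f = Matrix.det (Matrix.of fun i j : Fin k =>
      (MvPolynomial.X (a i, b j) : MvPolynomial (E × Fin s) ℤ))}

/-- The rank function of a finite matroid, on subsets of its ground set. -/
def rankFun {α : Type} (M : Matroid α) (A : Set M.E) : ℕ :=
  (M.eRk (Subtype.val '' A)).toNat

/-- The ideal generated by all minors of size `ρ(A) + 1` with rows in `A`, for all `A ⊆ E`. -/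
def repIdeal {α : Type} (M : Matroid α) (s : ℕ) : Ideal (MvPolynomial (M.E × Fin s) ℤ) :=
  Ideal.span (⋃ A : Set M.E, minors s A (rankFun M A + 1))

/-- The open subset of `Spec (ℤ[y] / repIdeal M s)` on which, for every `A ⊆ E`, at least one minor
of size `ρ(A)` with rows in `A` is invertible. (The intersection is finite for finite `M`.) -/
def repOpen {α : Type} (M : Matroid α) (s : ℕ) :
    (Spec (CommRingCat.of (MvPolynomial (M.E × Fin s) ℤ ⧸ repIdeal M s))).Opens :=
  ⨅ A : Set M.E, ⨆ m : minors s A (rankFun M A),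
    PrimeSpectrum.basicOpen (Ideal.Quotient.mk (repIdeal M s) m.1)

/-- `X(M, s)`: the scheme of representations of `M` in affine `s`-space, that is of functions `f`
from the ground set to `𝔸 ^ s` such that `f` restricted to `A` has rank exactly `ρ(A)` for every
subset `A` of the ground set. -/
def repScheme {α : Type} (M : Matroid α) (s : ℕ) : Scheme.{0} := (repOpen M s).toScheme

/-! ### The two modules -/

/-- `Graphs_*`: the `R`-module generated by the functions `[Z_G]`, for `G` a finite simple graph. -/
def graphsStar : Submodule R (PrimePower → ℚ) :=
  Submodule.span R
    {φ | ∃ (V : Type) (_ : Fintype V) (G : SimpleGraph V), φ = pointCount (ZScheme G)}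

/-- `Matroids`: the `R`-module generated by the functions `[X(M)]`, where `M` is a finite matroid
and `X(M) = X(M, r)` with `r` the rank of `M`. -/
def matroids : Submodule R (PrimePower → ℚ) :=
  Submodule.span R
    {φ | ∃ (α : Type) (M : Matroid α), M.Finite ∧ φ = pointCount (repScheme M M.eRank.toNat)}

end GraphMatroid

end

/-!
A symmetric matrix `B` over `𝔽_q` with rows indexed by `V` can be bordered by a vector `x` vanishing
on `A ⊆ V` and an arbitrary corner entry, which corresponds to adding a vertex adjacent to `A` to
the graph. The rank of the bordered matrix is `rk B + 2` unless `x` lies in the column space of `B`.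
The number of such `x` in the column space is `q ^ (rk B - rk B_A)`, where `B_A` consists of the
rows indexed by `A`. Repeated bordering thus weights each `B` by powers of `q ^ (|A| - rk B_A)`. As
`q ^ m - q ^ n` is invertible in `R` for `m ≠ n`, interpolation recovers from these weighted counts
the number of `B` with a given value of `rk B_A`, and likewise for several sets `A` at once.

A representation of a matroid on `E` in `s`-space is encoded, together with `s` nonzero scalars, in
the Gram matrix of its vectors and the standard basis for the diagonal form with these scalars as
coefficients. Such Gram matrices are the symmetric matrices of rank `s`, with prescribed zeros and
prescribed row ranks, in which the `s` rows of the basis vectors have rank `s`. There are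
`(q - 1) ^ s` of them for every representation, and `(q - 1) ^ s` is invertible in `R`.
-/

noncomputable section

open Polynomial AlgebraicGeometry

namespace GraphMatroid

/-! ### Row ranks -/

section RowRank

open Module Submodule

variable {K V W : Type*} [Field K]

/-- The rank of the family of rows of `B` indexed by `A`. -/
def rowRank (A : Set V) (B : Matrix V W K) : ℕ := finrank K (span K (B.row '' A))

theorem rowRank_univ [Finite V] [Fintype W] (B : Matrix V W K) :
    rowRank Set.univ B = B.rank := by
  rw [rowRank, Set.image_univ, B.rank_eq_finrank_span_row]

theorem rowRank_mono [Finite W] {A A' : Set V} (h : A ⊆ A') (B : Matrix V W K) :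
    rowRank A B ≤ rowRank A' B :=
  finrank_mono (span_mono (Set.image_mono h))

theorem rowRank_le_rank [Finite V] [Fintype W] (A : Set V) (B : Matrix V W K) :
    rowRank A B ≤ B.rank :=
  rowRank_univ B ▸ rowRank_mono (Set.subset_univ A) B

theorem rowRank_le_ncard [Finite V] (A : Set V) (B : Matrix V W K) :
    rowRank A B ≤ A.ncard := by
  have : Fintype (B.row '' A) := Fintype.ofFinite _
  refine (finrank_span_le_card (R := K) (B.row '' A)).trans ?_
  rw [← Set.ncard_eq_toFinset_card']
  exact Set.ncard_image_le

theorem rowRank_eq_rank_submatrix [Finite V] [Fintype W] (A : Set V) (B : Matrix V W K) :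
    rowRank A B = (B.submatrix ((↑) : A → V) id).rank := by
  rw [Matrix.rank_eq_finrank_span_row, rowRank, Set.image_eq_range]
  rfl

theorem rowRank_eq_of_image_row_eq {V' W' : Type*} {A : Set V} {A' : Set V'} {B : Matrix V W K}
    {B' : Matrix V' W' K} {φ : (W → K) →ₗ[K] (W' → K)} (hφ : Function.Injective φ)
    (h : B'.row '' A' = φ '' (B.row '' A)) : rowRank A' B' = rowRank A B := by
  rw [rowRank, h, span_image]
  exact (equivMapOfInjective φ hφ _).finrank_eq.symm

end RowRank

/-! ### Bordered symmetric matrices -/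

section Border

open Module Submodule Matrix

/-- The matrix on `Option V` obtained from the matrix `B` on `V` by adding `x` both as a row and as
a column, with the entry `c` on the diagonal. -/
def border {R V : Type*} (B : Matrix V V R) (x : V → R) (c : R) :
    Matrix (Option V) (Option V) R :=
  of fun i j => i.elim (j.elim c x) fun v => j.elim (x v) (B v)

theorem isSymm_border {R V : Type*} {B : Matrix V V R} {x : V → R} {c : R} :
    (border B x c).IsSymm ↔ B.IsSymm := by
  simp [IsSymm.ext_iff, Option.forall, border]

theorem range_row_border {R V : Type*} (B : Matrix V V R) (x : V → R) (c : R) :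
    Set.range (border B x c).row =
      insert (border B x c none) ((border B x c).row '' (some '' Set.univ)) := by
  rw [← Set.image_univ, ← Set.insert_none_range_some, Set.image_insert_eq, Set.image_univ]
  rfl

variable {K V : Type*} [Field K] [Fintype V]

theorem span_range_row_of_isSymm {B : Matrix V V K} (hB : B.IsSymm) :
    span K (Set.range B.row) = LinearMap.range B.mulVecLin := by
  rw [range_mulVecLin, ← row_transpose, hB.eq]

/-- The injection `b ↦ (b ⬝ᵥ y, b)`. If `x = B *ᵥ y`, it maps the rows of `B` to those of
`border B x c` indexed by `V`. -/
def consDot (y : V → K) : (V → K) →ₗ[K] (Option V → K) where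
  toFun b := fun i => i.elim (b ⬝ᵥ y) b
  map_add' a b := by ext (_ | _) <;> simp [add_dotProduct]
  map_smul' a b := by ext (_ | _) <;> simp

theorem consDot_injective (y : V → K) : Function.Injective (consDot y) :=
  fun _ _ h => funext fun v => congrFun h (some v)

section Rank

variable {A : Set V} {B : Matrix V V K} {x y : V → K} {c : K}

theorem image_row_border (h : ∀ v ∈ A, x v = B v ⬝ᵥ y) :
    (border B x c).row '' (some '' A) = consDot y '' (B.row '' A) := by
  simp only [Set.image_image]
  refine Set.image_congr fun v hv => ?_
  ext (_ | w)
  · exact h v hv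
  · rfl

theorem rowRank_border (h : ∀ v ∈ A, x v = B v ⬝ᵥ y) :
    rowRank (some '' A) (border B x c) = rowRank A B :=
  rowRank_eq_of_image_row_eq (consDot_injective y) (image_row_border h)

theorem border_none_mem_span_iff (hB : B.IsSymm) (hx : B *ᵥ y = x) :
    border B x c none ∈ span K ((border B x c).row '' (some '' Set.univ)) ↔ c = x ⬝ᵥ y := by
  rw [image_row_border fun v _ => (congrFun hx v).symm, span_image, Set.image_univ,
    span_range_row_of_isSymm hB]
  constructor
  · rintro ⟨b, -, hb⟩
    obtain rfl : b = x := funext fun v => congrFun hb (some v)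
    exact (congrFun hb none).symm
  · rintro rfl
    exact ⟨x, ⟨y, hx⟩, by ext (_ | v) <;> rfl⟩

theorem finrank_span_row_border (hx : B *ᵥ y = x) :
    finrank K (span K ((border B x c).row '' (some '' Set.univ))) = B.rank :=
  (rowRank_border fun v _ => (congrFun hx v).symm).trans (rowRank_univ B)

theorem rank_border_of_eq (hB : B.IsSymm) (hx : B *ᵥ y = x) (hc : c = x ⬝ᵥ y) :
    (border B x c).rank = B.rank := by
  rw [rank_eq_finrank_span_row, range_row_border,
    span_insert_eq_span ((border_none_mem_span_iff hB hx).2 hc), finrank_span_row_border hx]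

theorem rank_border_of_ne (hB : B.IsSymm) (hx : B *ᵥ y = x) (hc : c ≠ x ⬝ᵥ y) :
    (border B x c).rank = B.rank + 1 := by
  rw [rank_eq_finrank_span_row, range_row_border, span_insert, sup_comm,
    finrank_sup_span_singleton (mt (border_none_mem_span_iff hB hx).1 hc),
    finrank_span_row_border hx]

theorem rowRank_border_of_notMem (hx : x ∉ LinearMap.range B.mulVecLin) :
    rowRank (some '' Set.univ) (border B x c) = B.rank + 1 := by
  have h_rows : (border B x c).row '' (some '' Set.univ) =
      Set.range ((border B x c).submatrix some id).row := by
    rw [Set.image_image, Set.image_univ]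
    rfl
  have h_cols : Set.range ((border B x c).submatrix some id).col =
      insert x (Set.range B.col) := by
    rw [← Set.image_univ, ← Set.insert_none_range_some, Set.image_insert_eq, ← Set.range_comp]
    rfl
  rw [rowRank, h_rows, ← rank_eq_finrank_span_row, rank_eq_finrank_span_cols, h_cols,
    span_insert, sup_comm, ← range_mulVecLin, finrank_sup_span_singleton hx]
  rfl

theorem rank_border_of_notMem (hB : B.IsSymm) (hx : x ∉ LinearMap.range B.mulVecLin) :
    (border B x c).rank = B.rank + 2 := by
  rw [rank_eq_finrank_span_row, range_row_border, span_insert, sup_comm,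
    finrank_sup_span_singleton]
  · exact congrArg (· + 1) (rowRank_border_of_notMem hx)
  · refine fun h => hx ?_
    rw [← span_range_row_of_isSymm hB, ← Set.image_univ]
    have h_restrict := mem_map_of_mem (f := LinearMap.funLeft K K (some : V → Option V)) h
    rwa [← span_image, Set.image_image, Set.image_image] at h_restrict

end Rank

end Border

/-! ### Vectors vanishing on a set of coordinates -/

section Vanishing

open Module

variable {K V : Type*} [Field K]

theorem card_vanishing_mul [Finite K] [Finite V] (W : Submodule K (V → K)) (A : Set V) :
    Nat.card {x : V → K // x ∈ W ∧ ∀ v ∈ A, x v = 0} *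
        Nat.card K ^ finrank K (W.map (LinearMap.funLeft K K ((↑) : A → V))) =
      Nat.card K ^ finrank K W := by
  set restrict : W →ₗ[K] (A → K) := (LinearMap.funLeft K K ((↑) : A → V)).domRestrict W
  have e : {x : V → K // x ∈ W ∧ ∀ v ∈ A, x v = 0} ≃ LinearMap.ker restrict :=
    (Equiv.subtypeSubtypeEquivSubtypeInter (· ∈ W) _).symm.trans <|
      Equiv.subtypeEquivRight fun x =>
        ⟨fun h => funext fun v => h v v.2, fun h v hv => congrFun h ⟨v, hv⟩⟩
  rw [Nat.card_congr e, natCard_eq_pow_finrank (K := K) (V := LinearMap.ker restrict), ← pow_add,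
    add_comm, ← LinearMap.range_domRestrict, LinearMap.finrank_range_add_finrank_ker]

theorem card_range_vanishing_mul [Finite K] [Fintype V] (B : Matrix V V K) (A : Set V) :
    Nat.card {x : V → K // x ∈ LinearMap.range B.mulVecLin ∧ ∀ v ∈ A, x v = 0} *
      Nat.card K ^ rowRank A B = Nat.card K ^ B.rank := by
  rw [rowRank_eq_rank_submatrix, Matrix.rank, Matrix.rank, ← card_vanishing_mul _ A,
    ← LinearMap.range_comp]
  rfl

theorem card_vanishing_mul_pow_ncard [Finite K] [Fintype V] (A : Set V) :
    Nat.card {x : V → K // ∀ v ∈ A, x v = 0} * Nat.card K ^ A.ncard =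
      Nat.card K ^ Fintype.card V := by
  have h := card_vanishing_mul (⊤ : Submodule K (V → K)) A
  rw [Submodule.map_top, LinearMap.range_eq_top.2
    (LinearMap.funLeft_surjective_of_injective K K _ Subtype.val_injective)] at h
  have : Fintype A := Fintype.ofFinite A
  simpa only [Submodule.mem_top, true_and, finrank_top, finrank_fintype_fun_eq_card,
    Fintype.card_eq_nat_card, Nat.card_coe_set_eq] using h

end Vanishing

/-! ### Sums over symmetric matrices with prescribed zeros -/

section Sums

variable {V K : Type*} [Field K]

/-- The symmetric matrices over `K` whose entries vanish on the edges of `G`. -/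
abbrev GraphSymm (G : SimpleGraph V) (K : Type*) [Field K] : Type _ :=
  {B : Matrix V V K // B.IsSymm ∧ ∀ v w, G.Adj v w → B v w = 0}

instance [Finite V] [Finite K] (G : SimpleGraph V) : Fintype (GraphSymm G K) :=
  have : Finite (Matrix V V K) := inferInstanceAs (Finite (V → V → K))
  Fintype.ofFinite _

/-- The graph obtained from `G` by adding a new vertex, adjacent to the vertices in `A`. -/
def addVertex (G : SimpleGraph V) (A : Set V) : SimpleGraph (Option V) where
  Adj i j := i.elim (j.elim False (· ∈ A)) fun v => j.elim (v ∈ A) (G.Adj v)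
  symm := ⟨by rintro (_ | v) (_ | w) h <;> first | exact h | exact h.symm⟩
  loopless := ⟨by rintro (_ | v) h <;> first | exact h | exact G.loopless.irrefl v h⟩

/-- The matrices for `addVertex G A` are the matrices for `G`, bordered by the vectors that vanish
on `A`. -/
def borderEquiv (G : SimpleGraph V) (A : Set V) :
    GraphSymm G K × {x : V → K // ∀ v ∈ A, x v = 0} × K ≃ GraphSymm (addVertex G A) K where
  toFun p := ⟨border p.1.1 p.2.1.1 p.2.2, isSymm_border.2 p.1.2.1, by
    rintro (_ | v) (_ | w) h
    exacts [h.elim, p.2.1.2 w h, p.2.1.2 v h, p.1.2.2 v w h]⟩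
  invFun B := (⟨B.1.submatrix some some, B.2.1.submatrix _, fun v w h => B.2.2 (some v) (some w) h⟩,
    ⟨fun v => B.1 none (some v), fun v hv => B.2.2 none (some v) hv⟩, B.1 none none)
  left_inv _ := rfl
  right_inv B := by
    ext (_ | v) (_ | w)
    exacts [rfl, rfl, B.2.1.apply (some v) none, rfl]

/-- The defect `|A| - rk A` of the family of rows of `B` indexed by `A`. -/
def defect (A : Set V) (B : Matrix V V K) : ℕ := A.ncard - rowRank A B

theorem rowRank_add_defect [Finite V] (A : Set V) (B : Matrix V V K) :
    rowRank A B + defect A B = A.ncard :=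
  Nat.add_sub_cancel' (rowRank_le_ncard A B)

theorem sum_ite_const {ι : Type*} [Fintype ι] (p : ι → Prop) [DecidablePred p] (a b : ℚ) :
    ∑ i, (if p i then a else b) = Nat.card ι * b + Nat.card {i // p i} * (a - b) := by
  have h : ∀ i, (if p i then a else b) = b + if p i then a - b else 0 := fun i => by
    split_ifs <;> ring
  simp only [h, Finset.sum_add_distrib, ← Finset.sum_filter, Finset.sum_const, nsmul_eq_mul,
    Finset.card_univ, Nat.card_eq_fintype_card, Fintype.card_subtype]

theorem defect_border [Finite V] {A : Set V} {B : Matrix V V K} {x : V → K} {c : K}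
    (hx : ∀ v ∈ A, x v = 0) : defect (some '' A) (border B x c) = defect A B := by
  cases nonempty_fintype V
  rw [defect, defect, rowRank_border (y := 0) fun v hv => by rw [hx v hv, dotProduct_zero],
    Set.ncard_image_of_injective _ (Option.some_injective V)]

variable [Fintype V]

open scoped Classical in
theorem sum_rank_border_diagonal [Fintype K] {B : Matrix V V K} (hB : B.IsSymm) (g : ℕ → ℚ)
    (x : V → K) :
    ∑ c, g (border B x c).rank = if x ∈ LinearMap.range B.mulVecLin then
      g B.rank + (Nat.card K - 1) * g (B.rank + 1) else Nat.card K * g (B.rank + 2) := by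
  split_ifs with hx
  · obtain ⟨y, hy⟩ := hx
    have h : ∀ c, g (border B x c).rank = if c = x ⬝ᵥ y then g B.rank else g (B.rank + 1) :=
      fun c => by
        split_ifs with hc
        · rw [rank_border_of_eq hB hy hc]
        · rw [rank_border_of_ne hB hy hc]
    simp only [h, sum_ite_const, Nat.card_unique, Nat.cast_one]
    ring
  · simp only [rank_border_of_notMem hB hx, Finset.sum_const, Finset.card_univ, nsmul_eq_mul,
      Nat.card_eq_fintype_card]

open scoped Classical in
theorem sum_rank_border [Fintype K] {B : Matrix V V K} (hB : B.IsSymm) (A : Set V) (g : ℕ → ℚ) :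
    (Nat.card K : ℚ) ^ A.ncard *
        ∑ x : {x : V → K // ∀ v ∈ A, x v = 0}, ∑ c, g (border B x.1 c).rank =
      (Nat.card K : ℚ) ^ (B.rank + defect A B) * (g B.rank + (Nat.card K - 1) * g (B.rank + 1)) +
      ((Nat.card K : ℚ) ^ Fintype.card V - (Nat.card K : ℚ) ^ (B.rank + defect A B)) *
        (Nat.card K * g (B.rank + 2)) := by
  have h_all : (Nat.card {x : V → K // ∀ v ∈ A, x v = 0} : ℚ) * (Nat.card K : ℚ) ^ A.ncard =
      (Nat.card K : ℚ) ^ Fintype.card V := by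
    exact_mod_cast card_vanishing_mul_pow_ncard A
  have h_range : (Nat.card {x : {x : V → K // ∀ v ∈ A, x v = 0} //
        x.1 ∈ LinearMap.range B.mulVecLin} : ℚ) * (Nat.card K : ℚ) ^ A.ncard =
      (Nat.card K : ℚ) ^ (B.rank + defect A B) := by
    rw [Nat.card_congr (Equiv.subtypeSubtypeEquivSubtypeInter _ (· ∈ LinearMap.range B.mulVecLin)),
      ← rowRank_add_defect A B, pow_add, pow_add, ← mul_assoc]
    simp only [and_comm (b := _ ∈ LinearMap.range B.mulVecLin)]
    exact_mod_cast congrArg (· * Nat.card K ^ defect A B) (card_range_vanishing_mul B A)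
  simp only [sum_rank_border_diagonal hB g, sum_ite_const]
  rw [← h_all, ← h_range]
  ring

open scoped Classical in
theorem sum_addVertex [Fintype K] (G : SimpleGraph V) (A : Set V)
    (F : Matrix (Option V) (Option V) K → ℚ) :
    ∑ B : GraphSymm (addVertex G A) K, F B.1 = ∑ B : GraphSymm G K,
      ∑ x : {x : V → K // ∀ v ∈ A, x v = 0}, ∑ c, F (border B.1 x.1 c) := by
  rw [← (borderEquiv G A).sum_comp, Fintype.sum_prod_type]
  simp only [Fintype.sum_prod_type]
  rfl

theorem sum_addVertex_defect [Finite K] (G : SimpleGraph V) (A : Set V)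
    {f : Matrix (Option V) (Option V) K → ℚ} {g : Matrix V V K → ℕ → ℚ}
    (hfg : ∀ B x c, B.IsSymm → f (border B x c) = g B (border B x c).rank) (k : ℕ) :
    (Nat.card K : ℚ) ^ A.ncard * ∑ B : GraphSymm (addVertex G A) K,
        f B.1 * (Nat.card K : ℚ) ^ (k * defect (some '' A) B.1) =
      ∑ B : GraphSymm G K, (Nat.card K : ℚ) ^ (k * defect A B.1) *
        ((Nat.card K : ℚ) ^ (B.1.rank + defect A B.1) *
          (g B.1 B.1.rank + (Nat.card K - 1) * g B.1 (B.1.rank + 1)) +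
        ((Nat.card K : ℚ) ^ Fintype.card V - (Nat.card K : ℚ) ^ (B.1.rank + defect A B.1)) *
          (Nat.card K * g B.1 (B.1.rank + 2))) := by
  classical
  cases nonempty_fintype K
  rw [sum_addVertex G A fun B => f B * (Nat.card K : ℚ) ^ (k * defect (some '' A) B),
    Finset.mul_sum]
  refine Finset.sum_congr rfl fun B _ => ?_
  have h : ∀ x : {x : V → K // ∀ v ∈ A, x v = 0}, ∀ c,
      f (border B.1 x.1 c) * (Nat.card K : ℚ) ^ (k * defect (some '' A) (border B.1 x.1 c)) =
        (Nat.card K : ℚ) ^ (k * defect A B.1) * g B.1 (border B.1 x.1 c).rank := fun x c => by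
    rw [hfg _ _ _ B.2.1, defect_border x.2, mul_comm]
  simp only [h, ← Finset.mul_sum]
  rw [mul_left_comm, sum_rank_border B.2.1]

end Sums

/-! ### Rank and minors -/

section Minors

open Module Submodule Matrix

variable {K V W : Type*} [Field K]

theorem exists_linearIndependent_rows [Finite W] {A : Set V} {B : Matrix V W K} {k : ℕ}
    (hk : k ≤ rowRank A B) :
    ∃ a : Fin k ↪ V, (∀ i, a i ∈ A) ∧ LinearIndependent K fun i => B (a i) := by
  obtain ⟨f, hf, -, hl⟩ := exists_fun_fin_finrank_span_eq K (B.row '' A)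
  choose a ha hfa using hf
  obtain rfl : f = B.row ∘ a := funext fun i => (hfa i).symm
  refine ⟨(Fin.castLEEmb hk).trans ⟨a, hl.injective.of_comp⟩, fun i => ha _, ?_⟩
  exact hl.comp _ (Fin.castLE_injective hk)

theorem le_rowRank_iff_exists_minor [Finite V] [Finite W] {A : Set V} {B : Matrix V W K} {k : ℕ} :
    k ≤ rowRank A B ↔ ∃ (a : Fin k ↪ V) (b : Fin k ↪ W), (∀ i, a i ∈ A) ∧
      (B.submatrix a b).det ≠ 0 := by
  cases nonempty_fintype W
  constructor
  · intro hk
    obtain ⟨a, haA, ha⟩ := exists_linearIndependent_rows hk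
    have h_rank : rowRank Set.univ (B.submatrix a id)ᵀ = k := by
      rw [rowRank_univ, rank_transpose]
      exact (LinearIndependent.rank_matrix ha).trans (Fintype.card_fin k)
    obtain ⟨b, -, hb⟩ := exists_linearIndependent_rows h_rank.ge
    refine ⟨a, b, haA, ?_⟩
    rw [← det_transpose]
    exact ((isUnit_iff_isUnit_det _).1 (linearIndependent_rows_iff_isUnit.1 hb)).ne_zero
  · rintro ⟨a, b, ha, h_det⟩
    have h_rank := rank_of_det_ne_zero h_det
    rw [Fintype.card_fin] at h_rank
    rw [← h_rank, rowRank_eq_rank_submatrix]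
    exact rank_submatrix_le (B.submatrix ((↑) : A → V) id) (fun i => ⟨a i, ha i⟩) b

theorem rank_eq_card_iff_det_ne_zero [Fintype V] [DecidableEq V] {B : Matrix V V K} :
    B.rank = Fintype.card V ↔ B.det ≠ 0 := by
  refine ⟨fun h => ?_, rank_of_det_ne_zero⟩
  rw [rank_eq_finrank_span_row] at h
  exact ((isUnit_iff_isUnit_det _).1 (linearIndependent_rows_iff_isUnit.1
    (linearIndependent_iff_card_eq_finrank_span.2 h.symm))).ne_zero

end Minors

/-! ### Points of schemes with values in a ring -/

section Points

open CategoryTheory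

/-- Ring homomorphisms `ℤ[x] / (S) → R` are the zeros of `S` in `R`. -/
def quotientPoints {σ : Type*} (S : Set (MvPolynomial σ ℤ)) (R : Type*) [CommRing R] :
    (MvPolynomial σ ℤ ⧸ Ideal.span S →+* R) ≃
      {x : σ → R // ∀ f ∈ S, MvPolynomial.aeval x f = 0} :=
  (RingHom.liftOfSurjective _ Ideal.Quotient.mk_surjective).symm.trans <|
    MvPolynomial.homEquiv.subtypeEquiv <| MvPolynomial.homEquiv.symm.surjective.forall.2 fun x => by
      rw [Ideal.mk_ker, Ideal.span_le, Equiv.apply_symm_apply]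
      rfl

theorem aeval_quotientPoints {σ R : Type*} [CommRing R] {S : Set (MvPolynomial σ ℤ)}
    (φ : MvPolynomial σ ℤ ⧸ Ideal.span S →+* R) (f : MvPolynomial σ ℤ) :
    MvPolynomial.aeval (quotientPoints S R φ).1 f = φ (Ideal.Quotient.mk _ f) :=
  DFunLike.congr_fun
    (MvPolynomial.homEquiv.symm_apply_apply (φ.comp (Ideal.Quotient.mk (Ideal.span S)))) f

theorem aeval_det_X {σ n R : Type*} [CommRing R] [Fintype n] [DecidableEq n] (x : σ → R)
    (i : n → n → σ) :
    MvPolynomial.aeval x (Matrix.det (Matrix.of fun a b =>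
      (MvPolynomial.X (i a b) : MvPolynomial σ ℤ))) =
      Matrix.det (Matrix.of fun a b => x (i a b)) := by
  rw [AlgHom.map_det]
  congr 1
  ext a b
  simp

/-- Ring homomorphisms out of the localization `A[1/d]` are those out of `A` that map `d` to a
unit. -/
def awayPoints {A : Type*} [CommRing A] (d : A) (R : Type*) [CommRing R] :
    (Localization.Away d →+* R) ≃ {φ : A →+* R // IsUnit (φ d)} where
  toFun φ := ⟨φ.comp (algebraMap A _),
    (IsLocalization.Away.algebraMap_isUnit (S := Localization.Away d) d).map φ⟩
  invFun φ := IsLocalization.Away.lift d φ.2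
  left_inv _ := IsLocalization.ringHom_ext (Submonoid.powers d)
    (IsLocalization.Away.lift_comp d _)
  right_inv _ := Subtype.ext (IsLocalization.Away.lift_comp d _)

/-- Morphisms from `Spec R` to `Spec A` are ring homomorphisms from `A` to `R`. -/
def specPoints (A R : Type) [CommRing A] [CommRing R] :
    (Spec (CommRingCat.of R) ⟶ Spec (CommRingCat.of A)) ≃ (A →+* R) where
  toFun f := (Spec.preimage f).hom
  invFun φ := Spec.map (CommRingCat.ofHom φ)
  left_inv f := Spec.map_preimage f
  right_inv φ := congrArg CommRingCat.Hom.hom (Spec.preimage_map (CommRingCat.ofHom φ))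

/-- Morphisms to an open subscheme `U` of `Y` are the morphisms to `Y` that land in `U`. -/
def openPoints {Y : Scheme.{0}} (U : Y.Opens) (S : Scheme.{0}) :
    (S ⟶ U.toScheme) ≃ {f : S ⟶ Y // ∀ x, f x ∈ U} where
  toFun f := ⟨f ≫ U.ι, fun x => by
    rw [Scheme.Hom.comp_apply]
    exact (f x).2⟩
  invFun f := IsOpenImmersion.lift U.ι f.1 (by
    rw [U.range_ι]
    rintro _ ⟨x, rfl⟩
    exact f.2 x)
  left_inv _ := (IsOpenImmersion.lift_uniq _ _ _ _ rfl).symm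
  right_inv _ := Subtype.ext (IsOpenImmersion.lift_fac _ _ _)

theorem mem_iInf_iSup_basicOpen {A ι : Type*} {κ : ι → Type*} [CommRing A] [Finite ι]
    (a : ∀ i, κ i → A) (p : PrimeSpectrum A) :
    p ∈ (⨅ i, ⨆ k, PrimeSpectrum.basicOpen (a i k) : TopologicalSpace.Opens _) ↔
      ∀ i, ∃ k, a i k ∉ p.asIdeal := by
  rw [← SetLike.mem_coe, TopologicalSpace.Opens.coe_iInf, Set.mem_iInter]
  simp only [SetLike.mem_coe, TopologicalSpace.Opens.mem_iSup, PrimeSpectrum.mem_basicOpen]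

theorem mem_asIdeal_specPoints_symm {A K : Type} [CommRing A] [Field K] (φ : A →+* K) (a : A)
    (x : Spec (CommRingCat.of K)) :
    a ∈ ((specPoints A K).symm φ x).asIdeal ↔ φ a = 0 := by
  have h_bot : x.asIdeal = (⊥ : Ideal K) := (eq_bot_or_eq_top _).resolve_right x.isPrime.ne_top
  change φ a ∈ x.asIdeal ↔ _
  rw [h_bot]
  exact Ideal.mem_bot

theorem forall_specPoints_symm_mem_iff {A K : Type} [CommRing A] [Field K] (φ : A →+* K)
    {ι : Type*} {κ : ι → Type*} [Finite ι] (a : ∀ i, κ i → A) :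
    (∀ x, (specPoints A K).symm φ x ∈
      (⨅ i, ⨆ k, PrimeSpectrum.basicOpen (a i k) : TopologicalSpace.Opens _)) ↔
      ∀ i, ∃ k, φ (a i k) ≠ 0 := by
  have : Nonempty (Spec (CommRingCat.of K)) := inferInstanceAs (Nonempty (PrimeSpectrum K))
  refine (forall_congr' fun x => (mem_iInf_iSup_basicOpen a _).trans ?_).trans (forall_const _)
  exact forall_congr' fun i => exists_congr fun k =>
    not_congr (mem_asIdeal_specPoints_symm φ (a i k) x)

/-- The points of `Z_G` over a field `K` are the nondegenerate symmetric matrices over `K` that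
vanish on the edges of `G`. -/
def zSchemePoints {V : Type} [Fintype V] (G : SimpleGraph V) (K : Type) [Field K] :
    (Spec (CommRingCat.of K) ⟶ ZScheme G) ≃
      {B : GraphSymm G K // B.1.rank = Fintype.card V} :=
  (specPoints _ K).trans <| (awayPoints (symDet G) K).trans <|
    ((quotientPoints _ K).trans <| ((Equiv.curry V V K).trans Matrix.of).subtypeEquiv
      fun x => by
        constructor
        · refine fun h => ⟨Matrix.IsSymm.ext fun v w => ?_, fun v w hvw => ?_⟩
          · simpa [sub_eq_zero] using h _ (Or.inl ⟨w, v, rfl⟩)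
          · simpa using h _ (Or.inr ⟨v, w, hvw, rfl⟩)
        · rintro ⟨h_symm, h_adj⟩ _ (⟨v, w, rfl⟩ | ⟨v, w, hvw, rfl⟩)
          · simpa [sub_eq_zero] using h_symm.apply w v
          · simpa using h_adj v w hvw).subtypeEquiv fun φ => by
    classical
    rw [isUnit_iff_ne_zero, rank_eq_card_iff_det_ne_zero]
    exact not_congr (Eq.congr_left ((aeval_quotientPoints φ _).symm.trans (aeval_det_X _ _)))

theorem forall_minors_iff_rowRank_eq {E K : Type} [Finite E] [Field K] {s : ℕ} {ρ : Set E → ℕ}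
    {x : E × Fin s → K} :
    ((∀ f ∈ ⋃ A : Set E, minors s A (ρ A + 1), MvPolynomial.aeval x f = 0) ∧
      ∀ A : Set E, ∃ m : minors s A (ρ A), MvPolynomial.aeval x m.1 ≠ 0) ↔
    ∀ A, rowRank A (Matrix.of (Function.curry x)) = ρ A := by
  have h_minors (A : Set E) (k : ℕ) : k ≤ rowRank A (Matrix.of (Function.curry x)) ↔
      ∃ f ∈ minors s A k, MvPolynomial.aeval x f ≠ 0 := by
    rw [le_rowRank_iff_exists_minor]
    constructor
    · rintro ⟨a, b, ha, h_det⟩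
      exact ⟨_, ⟨a, b, ha, rfl⟩, by rwa [aeval_det_X]⟩
    · rintro ⟨_, ⟨a, b, ha, rfl⟩, h_det⟩
      exact ⟨a, b, ha, by rwa [aeval_det_X] at h_det⟩
  simp only [Set.mem_iUnion, forall_exists_index]
  rw [forall_comm, ← forall_and]
  refine forall_congr' fun A => ?_
  rw [le_antisymm_iff, ← not_lt, ← Nat.add_one_le_iff, h_minors, h_minors, Subtype.exists]
  simp only [not_exists, not_and, not_not, exists_prop]

/-- The points of the representation scheme of `M` over a field `K` are the matrices whose row
ranks are the ranks in `M`. -/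
def repSchemePoints {α : Type} (M : Matroid α) [M.Finite] (s : ℕ) (K : Type) [Field K] :
    (Spec (CommRingCat.of K) ⟶ repScheme M s) ≃
      {F : Matrix M.E (Fin s) K // ∀ A, rowRank A F = rankFun M A} :=
  have : Finite M.E := M.ground_finite
  (openPoints _ _).trans <|
    ((specPoints _ K).symm.subtypeEquiv fun φ =>
      (forall_specPoints_symm_mem_iff φ
        fun (A : Set M.E) (m : minors s A (rankFun M A)) =>
          Ideal.Quotient.mk (repIdeal M s) m.1).symm).symm.trans <|
    ((quotientPoints _ K).subtypeEquiv fun φ => by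
      simp only [aeval_quotientPoints]
      exact Iff.rfl).trans <|
    (Equiv.subtypeSubtypeEquivSubtypeInter _ fun x => ∀ A : Set M.E,
      ∃ m : minors s A (rankFun M A), MvPolynomial.aeval x m.1 ≠ 0).trans <|
    ((Equiv.curry M.E (Fin s) K).trans Matrix.of).subtypeEquiv fun _ =>
      forall_minors_iff_rowRank_eq

end Points

section FiniteField

instance (q : PrimePower) : Finite (Fq q) := by
  unfold Fq
  infer_instance

instance (q : PrimePower) : Fintype (Fq q) := Fintype.ofFinite _

theorem card_Fq (q : PrimePower) : Nat.card (Fq q) = q.1 := by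
  rw [GaloisField.card, q.2.minFac_pow_factorization_eq]
  exact (Nat.Prime.factorization_pos_of_dvd (Nat.minFac_prime q.2.ne_one) q.2.ne_zero
    (Nat.minFac_dvd _)).ne'

end FiniteField

/-! ### `R`-submodules of functions of prime powers -/

section Membership

theorem smul_eq_evalR_mul (r : R) (φ : PrimePower → ℚ) : r • φ = evalR r * φ := rfl

theorem evalR_algebraMap (p : ℤ[X]) : evalR (algebraMap ℤ[X] R p) = evalPoly p :=
  IsLocalization.lift_eq _ p

theorem evalPoly_X_pow_apply (n : ℕ) (q : PrimePower) : evalPoly (X ^ n) q = (q.1 : ℚ) ^ n := by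
  simp [evalPoly_apply]

theorem mem_denominators_of_dvd {p : ℤ[X]} {n : ℕ} (hn : 1 < n) (h : p ∣ X ^ n - X) :
    p ∈ denominators :=
  Submonoid.mem_saturation_iff_exists_dvd.2 ⟨_, Submonoid.subset_closure ⟨n, hn, rfl⟩, h⟩

theorem X_sub_one_pow_mem_denominators (n : ℕ) : ((X - 1) ^ n : ℤ[X]) ∈ denominators :=
  pow_mem (mem_denominators_of_dvd one_lt_two ⟨X, by ring⟩) n

theorem X_pow_mem_denominators (n : ℕ) : (X ^ n : ℤ[X]) ∈ denominators :=
  pow_mem (mem_denominators_of_dvd one_lt_two ⟨X - 1, by ring⟩) n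

theorem X_pow_sub_X_pow_mem_denominators {m n : ℕ} (h : m ≠ n) :
    (X ^ m - X ^ n : ℤ[X]) ∈ denominators := by
  wlog hnm : n < m generalizing m n
  · rw [← neg_sub, neg_eq_neg_one_mul]
    exact mul_mem (mem_denominators_of_dvd one_lt_two isUnit_one.neg.dvd)
      (this h.symm (h.lt_or_gt.resolve_right hnm))
  obtain ⟨d, rfl⟩ := Nat.exists_eq_add_of_lt hnm
  have h_factor : (X ^ (n + d + 1) - X ^ n : ℤ[X]) = X ^ n * (X ^ (d + 1) - 1) := by ring
  rw [h_factor]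
  exact mul_mem (X_pow_mem_denominators n)
    (mem_denominators_of_dvd (n := d + 2) (by omega) ⟨X, by ring⟩)

variable {N : Submodule R (PrimePower → ℚ)} {φ : PrimePower → ℚ}

theorem evalPoly_mul_mem (p : ℤ[X]) (h : φ ∈ N) : evalPoly p * φ ∈ N := by
  rw [← evalR_algebraMap, ← smul_eq_evalR_mul]
  exact N.smul_mem _ h

theorem mem_of_evalPoly_mul_mem {p : ℤ[X]} (hp : p ∈ denominators) (h : evalPoly p * φ ∈ N) :
    φ ∈ N := by
  rw [← evalR_algebraMap, ← smul_eq_evalR_mul] at h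
  exact (N.smul_mem_iff_of_isUnit (IsLocalization.map_units R (⟨p, hp⟩ : denominators))).1 h

variable {Ω : PrimePower → Type*} [∀ q, Fintype (Ω q)] {w : ∀ q, Ω q → ℚ} {e : ∀ q, Ω q → ℕ}

theorem sum_mul_eval₂_mem
    (h : ∀ k, (fun q : PrimePower => ∑ ω, w q ω * (q.1 : ℚ) ^ (k * e q ω)) ∈ N) (P : ℤ[X][X]) :
    (fun q : PrimePower => ∑ ω, w q ω *
      P.eval₂ ((Pi.evalRingHom _ q).comp evalPoly) ((q.1 : ℚ) ^ e q ω)) ∈ N := by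
  induction P using Polynomial.induction_on' with
  | add P Q hP hQ =>
    simp only [eval₂_add, mul_add, Finset.sum_add_distrib]
    exact N.add_mem hP hQ
  | monomial k p =>
    convert evalPoly_mul_mem p (h k) using 1
    ext q
    simp only [eval₂_monomial, Pi.mul_apply, Finset.mul_sum, ← pow_mul, mul_left_comm, mul_comm k]
    rfl

/-- Lagrange interpolation in the variable `q ^ e`, at the nodes `1, q, …, q ^ m`. -/
theorem sum_ite_eq_mem {m : ℕ} (he : ∀ q ω, e q ω ≤ m)
    (h : ∀ k, (fun q : PrimePower => ∑ ω, w q ω * (q.1 : ℚ) ^ (k * e q ω)) ∈ N) (d : ℕ) :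
    (fun q : PrimePower => ∑ ω, if e q ω = d then w q ω else 0) ∈ N := by
  have h_den : ∏ i ∈ (Finset.range (m + 1)).erase d, (X ^ d - X ^ i : ℤ[X]) ∈ denominators :=
    prod_mem fun i hi => X_pow_sub_X_pow_mem_denominators (Finset.ne_of_mem_erase hi).symm
  refine mem_of_evalPoly_mul_mem h_den ?_
  convert sum_mul_eval₂_mem h (∏ i ∈ (Finset.range (m + 1)).erase d, (X - C (X ^ i))) using 1
  ext q
  rw [Pi.mul_apply, Finset.mul_sum]
  refine Finset.sum_congr rfl fun ω _ => ?_
  simp only [map_prod, map_sub, Finset.prod_apply, Pi.sub_apply, evalPoly_X_pow_apply,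
    eval₂_finsetProd, eval₂_sub, eval₂_X, eval₂_C, RingHom.comp_apply, Pi.evalRingHom_apply]
  split_ifs with hd
  · rw [hd, mul_comm]
  · rw [mul_zero, Finset.prod_eq_zero
      (Finset.mem_erase.2 ⟨hd, Finset.mem_range_succ_iff.2 (he q ω)⟩) (sub_self _), mul_zero]

end Membership

/-! ### Counting symmetric matrices with prescribed row ranks -/

section RankConditions

variable {V K ι : Type*} [Field K] [Fintype V]

/-- The matrix `B` has rank `s`, this rank is already attained by the rows indexed by `T`, and for
every `i ∈ I` the rows indexed by `A i` have rank `ρ i`. -/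
def HasRanks (s : ℕ) (T : Set V) (I : Finset ι) (A : ι → Set V) (ρ : ι → ℕ) (B : Matrix V V K) :
    Prop :=
  B.rank = s ∧ rowRank T B = s ∧ ∀ i ∈ I, rowRank (A i) B = ρ i

variable {s : ℕ} {T : Set V} {I : Finset ι} {A : ι → Set V} {ρ : ι → ℕ}

theorem hasRanks_insert [DecidableEq ι] {i : ι} {B : Matrix V V K} :
    HasRanks s T (insert i I) A ρ B ↔ HasRanks s T I A ρ B ∧ rowRank (A i) B = ρ i := by
  rw [HasRanks, Finset.forall_mem_insert, HasRanks]
  tauto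

theorem hasRanks_border {B : Matrix V V K} (hB : B.IsSymm) (x : V → K) (c : K) :
    HasRanks s (some '' T) I (fun i => some '' A i) ρ (border B x c) ↔
      (border B x c).rank = B.rank ∧ HasRanks s T I A ρ B := by
  by_cases hx : x ∈ LinearMap.range B.mulVecLin
  · obtain ⟨y, hy⟩ := hx
    have h_rows (S : Set V) : rowRank (some '' S) (border B x c) = rowRank S B :=
      rowRank_border fun v _ => (congrFun hy v).symm
    have h_le : B.rank ≤ (border B x c).rank := by
      rw [← rowRank_univ B, ← h_rows]
      exact rowRank_le_rank _ _
    have h_T : rowRank T B ≤ B.rank := rowRank_le_rank T B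
    simp only [HasRanks, h_rows]
    constructor
    · rintro ⟨h_rank, h_rank_T, h_I⟩
      exact ⟨by omega, by omega, h_rank_T, h_I⟩
    · rintro ⟨h_rank, h_rank_B, h_I⟩
      exact ⟨h_rank.trans h_rank_B, h_I⟩
  · have h_rank := rank_border_of_notMem (c := c) hB hx
    refine iff_of_false (fun ⟨h_s, h_T, _⟩ => ?_) fun h => absurd (h_rank.symm.trans h.1) (by omega)
    have h_le := rowRank_mono (Set.image_mono (f := some) (Set.subset_univ T)) (border B x c)
    rw [rowRank_border_of_notMem hx] at h_le
    omega

end RankConditions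

section Counts

variable {V : Type}

/-- The number of symmetric matrices over `𝔽_q` that vanish on the edges of `G` and satisfy `P`,
as a function of `q`. -/
def matrixCount (G : SimpleGraph V) (P : ∀ q, Matrix V V (Fq q) → Prop) : PrimePower → ℚ :=
  fun q => Nat.card {B : GraphSymm G (Fq q) // P q B.1}

variable {G : SimpleGraph V} {P : ∀ q, Matrix V V (Fq q) → Prop} {A : Set V}

theorem matrixCount_eq_zero (h : ∀ q B, ¬ P q B) : matrixCount G P = 0 := by
  ext q
  simp [matrixCount, h]

section

variable [Finite V]

open scoped Classical in
/-- The count `matrixCount G P` with every matrix weighted by the `k`-th power of `q` to its defect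
on `A`. -/
def defectSum (G : SimpleGraph V) (P : ∀ q, Matrix V V (Fq q) → Prop) (A : Set V) (k : ℕ) :
    PrimePower → ℚ :=
  fun q => ∑ B : GraphSymm G (Fq q),
    (if P q B.1 then 1 else 0) * (q.1 : ℚ) ^ (k * defect A B.1)

open scoped Classical in
theorem matrixCount_apply (q : PrimePower) :
    matrixCount G P q = ∑ B : GraphSymm G (Fq q), if P q B.1 then 1 else 0 := by
  rw [Finset.sum_boole, matrixCount, Nat.card_eq_fintype_card, Fintype.card_subtype]

theorem defectSum_apply [∀ q, DecidablePred (P q)] (k : ℕ) (q : PrimePower) :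
    defectSum G P A k q = ∑ B : GraphSymm G (Fq q),
      (if P q B.1 then 1 else 0) * (q.1 : ℚ) ^ (k * defect A B.1) := by
  unfold defectSum
  congr!

theorem defectSum_eq_zero (h : ∀ q B, ¬ P q B) (k : ℕ) : defectSum G P A k = 0 := by
  ext q
  simp [defectSum, h]

theorem defectSum_zero : defectSum G P A 0 = matrixCount G P := by
  ext q
  simp [matrixCount_apply, defectSum]

theorem defectSum_empty (k : ℕ) : defectSum G P ∅ k = matrixCount G P := by
  ext q
  simp [matrixCount_apply, defectSum, defect]

theorem matrixCount_and_rowRank_mem {N : Submodule R (PrimePower → ℚ)}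
    (h : ∀ k, defectSum G P A k ∈ N) (ρ : ℕ) :
    matrixCount G (fun q B => P q B ∧ rowRank A B = ρ) ∈ N := by
  classical
  by_cases hρ : ρ ≤ A.ncard
  · convert sum_ite_eq_mem (fun q (B : GraphSymm G (Fq q)) => Nat.sub_le A.ncard (rowRank A B.1)) h
      (A.ncard - ρ) using 1
    ext q
    rw [matrixCount_apply]
    refine Finset.sum_congr rfl fun B _ => ?_
    have h_iff : A.ncard - rowRank A B.1 = A.ncard - ρ ↔ rowRank A B.1 = ρ := by
      have := rowRank_le_ncard A B.1
      omega
    simp only [h_iff, and_comm (a := P q B.1), ite_and]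
  · rw [matrixCount_eq_zero (P := fun q B => P q B ∧ rowRank A B = ρ) fun q B hB =>
      hρ (hB.2 ▸ rowRank_le_ncard A B)]
    exact N.zero_mem

end

variable [Fintype V]

theorem matrixCount_rank_eq_card :
    matrixCount G (fun _ B => B.rank = Fintype.card V) = pointCount (ZScheme G) := by
  ext q
  exact congrArg _ (Nat.card_congr (zSchemePoints G (Fq q))).symm

theorem defectSum_addVertex_rank (G : SimpleGraph V) (A : Set V) (s k : ℕ) :
    evalPoly (X ^ (A.ncard + 1)) *
        defectSum (addVertex G A) (fun _ B => B.rank = s) (some '' A) k =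
      evalPoly (X ^ (s + 1)) * defectSum G (fun _ B => B.rank = s) A (k + 1) +
      evalPoly (X ^ (s + 1) - X ^ s) * defectSum G (fun _ B => B.rank + 1 = s) A (k + 1) +
      evalPoly (X ^ (Fintype.card V + 2)) * defectSum G (fun _ B => B.rank + 2 = s) A k -
      evalPoly (X ^ s) * defectSum G (fun _ B => B.rank + 2 = s) A (k + 1) := by
  classical
  ext q
  have h_rec := sum_addVertex_defect (K := Fq q) G A (f := fun B => if B.rank = s then 1 else 0)
    (g := fun _ r => if r = s then 1 else 0) (fun _ _ _ _ => rfl) k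
  rw [card_Fq] at h_rec
  simp only [Pi.add_apply, Pi.sub_apply, Pi.mul_apply, map_sub, evalPoly_X_pow_apply,
    defectSum_apply]
  rw [pow_succ', mul_assoc, h_rec]
  simp only [Finset.mul_sum, ← Finset.sum_add_distrib, ← Finset.sum_sub_distrib]
  refine Finset.sum_congr rfl fun B _ => ?_
  by_cases h₀ : B.1.rank = s
  · simp only [← h₀, ↓reduceIte, Nat.add_eq_left, one_ne_zero, OfNat.ofNat_ne_zero, mul_zero,
      zero_mul, mul_one, one_mul, add_zero, sub_zero]
    ring
  by_cases h₁ : B.1.rank + 1 = s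
  · simp only [← h₁, ↓reduceIte, Nat.left_eq_add, Nat.add_left_cancel_iff, one_ne_zero,
      OfNat.ofNat_ne_one, mul_zero, zero_mul, mul_one, one_mul, add_zero, zero_add, sub_zero]
    ring
  by_cases h₂ : B.1.rank + 2 = s
  · simp only [← h₂, ↓reduceIte, Nat.left_eq_add, Nat.add_left_cancel_iff, OfNat.ofNat_ne_zero,
      OfNat.one_ne_ofNat, mul_zero, zero_mul, mul_one, one_mul, add_zero, zero_add]
    ring
  · simp [h₀, h₁, h₂]

theorem matrixCount_addVertex_rank (G : SimpleGraph V) (s : ℕ) :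
    evalPoly (X ^ (Fintype.card V + 2) - X ^ (s + 2)) * matrixCount G (fun _ B => B.rank = s) =
      evalPoly X * matrixCount (addVertex G ∅) (fun _ B => B.rank = s + 2) -
      (evalPoly (X ^ (s + 3)) * matrixCount G (fun _ B => B.rank = s + 2) +
      evalPoly (X ^ (s + 3) - X ^ (s + 2)) * matrixCount G (fun _ B => B.rank = s + 1)) := by
  have h_rec := defectSum_addVertex_rank G ∅ (s + 2) 0
  simp only [Set.image_empty, defectSum_empty, Set.ncard_empty, zero_add, pow_one,
    Nat.add_right_cancel_iff] at h_rec
  rw [h_rec, map_sub, map_sub]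
  ring

/-- The induction is on the corank `|V| - s`, which drops by one when an isolated vertex is added
and `s` is raised by two. -/
theorem matrixCount_rank_mem (G : SimpleGraph V) (s : ℕ) :
    matrixCount G (fun _ B => B.rank = s) ∈ graphsStar := by
  induction hd : Fintype.card V - s using Nat.strong_induction_on generalizing V s with
  | _ d ih =>
    rcases lt_trichotomy s (Fintype.card V) with hs | rfl | hs
    · refine mem_of_evalPoly_mul_mem
        (X_pow_sub_X_pow_mem_denominators (m := Fintype.card V + 2) (n := s + 2) (by omega)) ?_
      rw [matrixCount_addVertex_rank]
      refine sub_mem (evalPoly_mul_mem _ (ih _ ?_ _ _ rfl))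
        (add_mem (evalPoly_mul_mem _ (ih _ ?_ _ _ rfl)) (evalPoly_mul_mem _ (ih _ ?_ _ _ rfl)))
      · rw [Fintype.card_option]
        omega
      all_goals omega
    · rw [matrixCount_rank_eq_card]
      exact Submodule.subset_span ⟨V, inferInstance, G, rfl⟩
    · rw [matrixCount_eq_zero fun q B => (B.rank_le_card_width.trans_lt hs).ne]
      exact graphsStar.zero_mem

theorem defectSum_rank_add_mem {N : Submodule R (PrimePower → ℚ)} {s j k : ℕ}
    (h : ∀ t, t + j = s → defectSum G (fun _ B => B.rank = t) A k ∈ N) :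
    defectSum G (fun _ B => B.rank + j = s) A k ∈ N := by
  by_cases hj : j ≤ s
  · obtain ⟨t, rfl⟩ := Nat.exists_eq_add_of_le' hj
    simpa only [Nat.add_right_cancel_iff] using h t rfl
  · rw [defectSum_eq_zero fun q B => by omega]
    exact N.zero_mem

theorem defectSum_rank_mem (G : SimpleGraph V) (A : Set V) (s k : ℕ) :
    defectSum G (fun _ B => B.rank = s) A k ∈ graphsStar := by
  induction k generalizing V s with
  | zero => simpa only [defectSum_zero] using matrixCount_rank_mem G s
  | succ k ih =>
    induction s using Nat.strong_induction_on with
    | _ s ihs =>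
      refine mem_of_evalPoly_mul_mem (X_pow_mem_denominators (s + 1)) ?_
      have h_lower (j : ℕ) (hj : 0 < j) :
          defectSum G (fun _ B => B.rank + j = s) A (k + 1) ∈ graphsStar :=
        defectSum_rank_add_mem fun t ht => ihs t (by omega)
      have h_lower_k : defectSum G (fun _ B => B.rank + 2 = s) A k ∈ graphsStar :=
        defectSum_rank_add_mem fun t _ => ih G A t
      rw [eq_sub_of_add_eq (eq_sub_of_add_eq
        (eq_add_of_sub_eq (defectSum_addVertex_rank G A s k).symm))]
      exact sub_mem (sub_mem (add_mem (evalPoly_mul_mem _ (ih _ _ s))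
        (evalPoly_mul_mem _ (h_lower 2 two_pos))) (evalPoly_mul_mem _ h_lower_k))
        (evalPoly_mul_mem _ (h_lower 1 one_pos))

variable {ι : Type*}

theorem defectSum_addVertex_hasRanks (G : SimpleGraph V) (s : ℕ) (T : Set V) (I : Finset ι)
    (A : ι → Set V) (ρ : ι → ℕ) (S : Set V) (k : ℕ) :
    evalPoly (X ^ S.ncard) * defectSum (addVertex G S)
        (fun _ B => HasRanks s (some '' T) I (fun i => some '' A i) ρ B) (some '' S) k =
      evalPoly (X ^ s) * defectSum G (fun _ B => HasRanks s T I A ρ B) S (k + 1) := by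
  classical
  ext q
  have h_rec := sum_addVertex_defect (K := Fq q) G S
    (f := fun B => if HasRanks s (some '' T) I (fun i => some '' A i) ρ B then 1 else 0)
    (g := fun B r => if r = B.rank ∧ HasRanks s T I A ρ B then 1 else 0)
    (fun B x c hB => if_congr (hasRanks_border hB x c) rfl rfl) k
  rw [card_Fq] at h_rec
  simp only [Pi.mul_apply, evalPoly_X_pow_apply, defectSum]
  rw [h_rec, Finset.mul_sum]
  refine Finset.sum_congr rfl fun B _ => ?_
  by_cases hB : HasRanks s T I A ρ B.1
  · simp only [hB, hB.1, and_true, and_self, ↓reduceIte, Nat.add_eq_left, one_ne_zero,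
      OfNat.ofNat_ne_zero, mul_zero, mul_one, one_mul, add_zero]
    ring
  · simp [hB]

theorem defectSum_hasRanks_mem {s : ℕ} {I : Finset ι} {ρ : ι → ℕ}
    (h : ∀ (V : Type) [Fintype V] (G : SimpleGraph V) (T : Set V) (A : ι → Set V),
      matrixCount G (fun _ B => HasRanks s T I A ρ B) ∈ graphsStar)
    (G : SimpleGraph V) (T : Set V) (A : ι → Set V) (S : Set V) (k : ℕ) :
    defectSum G (fun _ B => HasRanks s T I A ρ B) S k ∈ graphsStar := by
  induction k generalizing V with
  | zero => simpa only [defectSum_zero] using h V G T A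
  | succ k ih =>
    refine mem_of_evalPoly_mul_mem (X_pow_mem_denominators s) ?_
    rw [← defectSum_addVertex_hasRanks]
    exact evalPoly_mul_mem _ (ih _ _ _ _)

theorem matrixCount_hasRanks_mem (G : SimpleGraph V) (s : ℕ) (T : Set V) (I : Finset ι)
    (A : ι → Set V) (ρ : ι → ℕ) : matrixCount G (fun _ B => HasRanks s T I A ρ B) ∈ graphsStar := by
  classical
  induction I using Finset.induction_on generalizing V with
  | empty =>
    simp only [HasRanks, Finset.notMem_empty, false_imp_iff, implies_true, and_true]
    exact matrixCount_and_rowRank_mem (defectSum_rank_mem G T s) s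
  | insert i I _ ih =>
    simp only [hasRanks_insert]
    exact matrixCount_and_rowRank_mem
      (defectSum_hasRanks_mem (fun V _ G T A => ih G T A) G T A (A i)) (ρ i)

end Counts

/-! ### Gram matrices of representations -/

section Frame

open Matrix Module Submodule
open scoped SimpleGraph

variable {E n K : Type*} [Field K]

/-- The graph on `E ⊕ n` in which distinct elements of `n` are adjacent, and nothing else. -/
abbrev frameGraph (E n : Type*) : SimpleGraph (E ⊕ n) := (⊥ : SimpleGraph E) ⊕g (⊤ : SimpleGraph n)

variable [Fintype n]

theorem rowRank_mul_of_mul_eq_one [DecidableEq n] {V m : Type*} [Fintype m] (S : Set V)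
    (P : Matrix V n K) {C : Matrix n m K} {C' : Matrix m n K} (h : C * C' = 1) :
    rowRank S (P * C) = rowRank S P := by
  refine rowRank_eq_of_image_row_eq (φ := C.vecMulLinear) (fun x y hxy => ?_) ?_
  · simpa [vecMul_vecMul, h] using congrArg (· ᵥ* C') hxy
  · rw [Set.image_image]
    rfl

theorem exists_eq_fromRows_mul [DecidableEq n] [Finite E] {m : Type*} [Fintype m]
    {B : Matrix (E ⊕ n) m K} (h : rowRank (Set.range Sum.inr) B = B.rank) :
    ∃ Y : Matrix E n K, B = fromRows Y 1 * B.toRows₂ := by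
  have h_rows : B.row '' Set.range Sum.inr = Set.range B.toRows₂.row := (Set.range_comp _ _).symm
  have h_span : span K (Set.range B.toRows₂.row) = span K (Set.range B.row) := by
    rw [← h_rows]
    refine eq_of_le_of_finrank_eq (span_mono (Set.image_subset_range _ _)) ?_
    rw [← B.rank_eq_finrank_span_row]
    exact h
  have h_comb (e : E) : ∃ y : n → K, ∑ j, y j • B.toRows₂.row j = B.row (Sum.inl e) := by
    rw [← mem_span_range_iff_exists_fun, h_span]
    exact subset_span ⟨Sum.inl e, rfl⟩
  choose Y hY using h_comb
  refine ⟨of Y, ?_⟩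
  rw [fromRows_mul, Matrix.one_mul, ← fromRows_toRows B]
  congr 1
  ext e j
  simpa [mul_apply] using (congrFun (hY e) j).symm

theorem exists_eq_fromRows_mul_mul_transpose [DecidableEq n] [Fintype E]
    {B : Matrix (E ⊕ n) (E ⊕ n) K} (hB : B.IsSymm) (h : rowRank (Set.range Sum.inr) B = B.rank) :
    ∃ Y : Matrix E n K, B = fromRows Y 1 * B.toBlocks₂₂ * (fromRows Y 1)ᵀ := by
  obtain ⟨Y, hY⟩ := exists_eq_fromRows_mul h
  have h_cols : B.toRows₂ᵀ = fromRows Y 1 * B.toBlocks₂₂ := by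
    calc B.toRows₂ᵀ = Bᵀ.toCols₂ := rfl
      _ = (fromRows Y 1 * B.toRows₂).toCols₂ := by rw [hB.eq, ← hY]
      _ = fromRows Y 1 * B.toBlocks₂₂ := rfl
  refine ⟨Y, hY.trans ?_⟩
  rw [Matrix.mul_assoc, ← transpose_transpose B.toRows₂, h_cols, transpose_mul,
    show B.toBlocks₂₂ᵀ = B.toBlocks₂₂ from hB.submatrix _]

variable [DecidableEq n]

/-- The Gram matrix of the rows of `Y` and the standard basis vectors for the diagonal form with
coefficients `d`. -/
def frameMatrix (Y : Matrix E n K) (d : n → Kˣ) : Matrix (E ⊕ n) (E ⊕ n) K :=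
  fromRows Y 1 * diagonal (fun i => (d i : K)) * (fromRows Y 1)ᵀ

theorem frameMatrix_eq_fromBlocks (Y : Matrix E n K) (d : n → Kˣ) :
    frameMatrix Y d = fromBlocks (Y * diagonal (fun i => (d i : K)) * Yᵀ)
      (Y * diagonal fun i => (d i : K)) (diagonal (fun i => (d i : K)) * Yᵀ)
      (diagonal fun i => (d i : K)) := by
  rw [frameMatrix, fromRows_mul, transpose_fromRows, fromRows_mul_fromCols, Matrix.one_mul,
    transpose_one, Matrix.mul_one, Matrix.mul_one]

theorem isSymm_frameMatrix (Y : Matrix E n K) (d : n → Kˣ) : (frameMatrix Y d).IsSymm := by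
  rw [IsSymm, frameMatrix, transpose_mul, transpose_mul, transpose_transpose, diagonal_transpose,
    Matrix.mul_assoc]

theorem frameMatrix_apply_of_adj (Y : Matrix E n K) (d : n → Kˣ) {v w : E ⊕ n}
    (h : (frameGraph E n).Adj v w) : frameMatrix Y d v w = 0 := by
  rw [frameMatrix_eq_fromBlocks]
  rcases v with v | v <;> rcases w with w | w
  · simp at h
  · simp at h
  · simp at h
  · exact (fromBlocks_apply₂₂ _ _ _ _ v w).trans (diagonal_apply_ne _ (by simpa using h))

theorem frameMatrix_injective :
    Function.Injective fun p : Matrix E n K × (n → Kˣ) => frameMatrix p.1 p.2 := by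
  rintro ⟨Y, d⟩ ⟨Y', d'⟩ h
  simp only [frameMatrix_eq_fromBlocks, fromBlocks_inj] at h
  obtain ⟨-, h_Y, -, h_d⟩ := h
  obtain rfl : d = d' := funext fun i => Units.ext (congrFun (diagonal_injective h_d) i)
  refine Prod.ext (Matrix.ext fun e j => mul_right_cancel₀ (d j).ne_zero ?_) rfl
  simpa only [mul_diagonal] using congrFun₂ h_Y e j

section

variable [Finite E]

theorem rowRank_frameMatrix (Y : Matrix E n K) (d : n → Kˣ) (S : Set (E ⊕ n)) :
    rowRank S (frameMatrix Y d) = rowRank S (fromRows Y 1) := by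
  cases nonempty_fintype E
  rw [frameMatrix, Matrix.mul_assoc]
  refine rowRank_mul_of_mul_eq_one (C' := fromRows 0 (diagonal fun i => ((d i)⁻¹ : Kˣ).1)) _ _ ?_
  rw [Matrix.mul_assoc, transpose_fromRows, fromCols_mul_fromRows, Matrix.mul_zero, zero_add,
    transpose_one, Matrix.one_mul, diagonal_mul_diagonal]
  simp

theorem rowRank_frameMatrix_inl (Y : Matrix E n K) (d : n → Kˣ) (A : Set E) :
    rowRank (Sum.inl '' A) (frameMatrix Y d) = rowRank A Y := by
  rw [rowRank_frameMatrix, rowRank, rowRank, Set.image_image]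
  rfl

theorem rowRank_frameMatrix_inr (Y : Matrix E n K) (d : n → Kˣ) :
    rowRank (Set.range Sum.inr) (frameMatrix Y d) = Fintype.card n := by
  rw [rowRank_frameMatrix, ← rank_one (R := K) (n := n), ← rowRank_univ, rowRank, rowRank,
    ← Set.image_univ, Set.image_image]
  rfl

end

variable [Fintype E]

theorem rank_frameMatrix (Y : Matrix E n K) (d : n → Kˣ) :
    (frameMatrix Y d).rank = Fintype.card n := by
  refine le_antisymm ?_ ((rowRank_frameMatrix_inr Y d).ge.trans (rowRank_le_rank _ _))
  rw [frameMatrix, Matrix.mul_assoc]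
  exact (rank_mul_le_left _ _).trans (rank_le_card_width _)

theorem exists_eq_frameMatrix {B : Matrix (E ⊕ n) (E ⊕ n) K} (hB : B.IsSymm)
    (h_adj : ∀ v w, (frameGraph E n).Adj v w → B v w = 0) (h_rank : B.rank = Fintype.card n)
    (h_inr : rowRank (Set.range Sum.inr) B = Fintype.card n) :
    ∃ (Y : Matrix E n K) (d : n → Kˣ), frameMatrix Y d = B := by
  obtain ⟨Y, hY⟩ := exists_eq_fromRows_mul_mul_transpose hB (h_inr.trans h_rank.symm)
  have h_diag : diagonal B.toBlocks₂₂.diag = B.toBlocks₂₂ :=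
    (isDiag_iff_diagonal_diag _).1 fun i j hij => h_adj (Sum.inr i) (Sum.inr j) hij
  have h_det : B.toBlocks₂₂.det ≠ 0 := by
    rw [← rank_eq_card_iff_det_ne_zero]
    refine (rank_le_card_width _).antisymm ?_
    calc Fintype.card n = B.rank := h_rank.symm
      _ = (fromRows Y 1 * B.toBlocks₂₂ * (fromRows Y 1)ᵀ).rank := congrArg rank hY
      _ ≤ B.toBlocks₂₂.rank := (rank_mul_le_left _ _).trans (rank_mul_le_right _ _)
  rw [← h_diag, det_diagonal, Finset.prod_ne_zero_iff] at h_det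
  refine ⟨Y, fun i => Units.mk0 (B.toBlocks₂₂.diag i) (h_det i (Finset.mem_univ i)), ?_⟩
  simp only [frameMatrix, Units.val_mk0]
  exact (congrArg (fromRows Y 1 * · * (fromRows Y 1)ᵀ) h_diag).trans hY.symm

end Frame

theorem matrixCount_frameGraph {E : Type} [Fintype E] (s : ℕ) (ρ : Set E → ℕ) :
    matrixCount (frameGraph E (Fin s)) (fun _ B => HasRanks s (Set.range Sum.inr)
      (Finset.univ : Finset (Set E)) (Sum.inl '' ·) ρ B) = evalPoly ((X - 1) ^ s) *
      fun q => (Nat.card {F : Matrix E (Fin s) (Fq q) // ∀ A, rowRank A F = ρ A} : ℚ) := by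
  ext q
  let f : {F : Matrix E (Fin s) (Fq q) // ∀ A, rowRank A F = ρ A} × (Fin s → (Fq q)ˣ) →
      {B : GraphSymm (frameGraph E (Fin s)) (Fq q) // HasRanks s (Set.range Sum.inr)
        (Finset.univ : Finset (Set E)) (Sum.inl '' ·) ρ B.1} :=
    fun p => ⟨⟨frameMatrix p.1.1 p.2, isSymm_frameMatrix _ _,
        fun _ _ => frameMatrix_apply_of_adj _ _⟩,
      (rank_frameMatrix _ _).trans (Fintype.card_fin s),
      (rowRank_frameMatrix_inr _ _).trans (Fintype.card_fin s),
      fun A _ => (rowRank_frameMatrix_inl _ _ A).trans (p.1.2 A)⟩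
  have hf : Function.Bijective f := by
    constructor
    · rintro ⟨⟨F, hF⟩, d⟩ ⟨⟨F', hF'⟩, d'⟩ h
      obtain ⟨rfl, rfl⟩ := Prod.mk.inj (@frameMatrix_injective _ _ _ _ _ _ (F, d) (F', d')
        (congrArg (fun B => B.1.1) h))
      rfl
    · rintro ⟨⟨B, h_symm, h_adj⟩, h_rank, h_inr, h_inl⟩
      obtain ⟨F, d, rfl⟩ := exists_eq_frameMatrix h_symm h_adj
        (h_rank.trans (Fintype.card_fin s).symm) (h_inr.trans (Fintype.card_fin s).symm)
      exact ⟨(⟨F, fun A =>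
        (rowRank_frameMatrix_inl F d A).symm.trans (h_inl A (Finset.mem_univ A))⟩, d), rfl⟩
  have h_units : (Nat.card (Fq q)ˣ : ℚ) = (q.1 : ℚ) - 1 := by
    rw [Nat.card_units, card_Fq, Nat.cast_sub q.2.one_lt.le, Nat.cast_one]
  rw [matrixCount, ← Nat.card_congr (Equiv.ofBijective f hf), Nat.card_prod, Nat.card_fun,
    Nat.card_fin, Nat.cast_mul, Nat.cast_pow, h_units, mul_comm]
  simp [evalPoly_apply]

end GraphMatroid

end

theorem mainTheorem3_general {α : Type} (M : Matroid α) [M.Finite] (s : ℕ) :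
    GraphMatroid.pointCount (GraphMatroid.repScheme M s) ∈ GraphMatroid.graphsStar := by
  have : Finite M.E := M.ground_finite
  cases nonempty_fintype M.E
  refine GraphMatroid.mem_of_evalPoly_mul_mem (GraphMatroid.X_sub_one_pow_mem_denominators s) ?_
  have h_points : GraphMatroid.pointCount (GraphMatroid.repScheme M s) = fun q =>
      (Nat.card {F : Matrix M.E (Fin s) (GraphMatroid.Fq q) //
        ∀ A, GraphMatroid.rowRank A F = GraphMatroid.rankFun M A} : ℚ) := by
    ext q
    exact congrArg _ (Nat.card_congr (GraphMatroid.repSchemePoints M s _))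
  rw [h_points, ← GraphMatroid.matrixCount_frameGraph]
  exact GraphMatroid.matrixCount_hasRanks_mem _ _ _ _ _ _

theorem mainTheorem3 : GraphMatroid.matroids ≤ GraphMatroid.graphsStar := by
  refine Submodule.span_le.2 ?_
  rintro _ ⟨α, M, hM, rfl⟩
  exact mainTheorem3_general M _
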